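/- Let $n\ge 1$. For $p\in[-\infty,\infty]$, $\lambda\in(0,1)$ and $a,b\in(0,\infty]$ let $M_p^{\lambda}(a,b)=(\lambda a^p+(1-\lambda)b^p)^{1/p}$, read as $\max(a,b)$ if $p=\infty$, as $\min(a,b)$ if $p=-\infty$, and as $a^\lambda b^{1-\lambda}$ if $p=0$. A measurable function $w:\mathbb R^n\to[0,\infty)$ is $p$-concave if $w(\lambda x+(1-\lambda)y)\ge M_p^\lambda(w(x),w(y))$ for all $\lambda\in(0,1)$ and all $x,y$ with $w(x)w(y)>0$; it is $p$-homogeneous if $w(\lambda x)^p=\lambda w(x)^p$ for all $x\in\mathbb R^n$, $\lambda>0$ (for $p=\infty$: $w(\lambda x)=w(x)$). A Borel measure $\mu$ on $\mathbb R^n$ is $q$-concave if $\mu(\lambda A+(1-\lambda)B)\ge M_q^\lambda(\mu(A),\mu(B))$ for all $\lambda\in(0,1)$ and all Borel sets $A,B$ with $\mu(A)\mu(B)>0$; it is $q$-homogeneous if $\mu(\lambda A)^q=\lambda\mu(A)^q$ for all Borel $A$ and $\lambda>0$. A semi-norm is a function $\|\cdot\|_K:\mathbb R^n\to[0,\infty)$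 which is subadditive and satisfies $\|\lambda x\|_K=\lambda\|x\|_K$ for all $\lambda\ge0$ (it need not be symmetric); $K=\{x:\|x\|_K<1\}$ is its open unit ball. The outer boundary measure of a Borel set $A$ is $\mu^+_K(A)=\liminf_{\epsilon\to0^+}\mu((A+\epsilon K)\setminus A)/\epsilon$. For a Borel measure $\mu$, an exponent $q\in(0,1]$ and such a $K$, consider the following assertion. $(\ast)$ For every Borel set $A$ with $\mu(A)<\infty$, $$\mu^+_K(A)\ \ge\ \frac1q\,\mu(K)^q\,\mu(A)^{1-q},$$ where the right-hand side is read as $0$ if $\mu(A)=0$. Equality holds for $A=tK$ for every $t>0$ with $\mu(tK)<\infty$, and every such $tK$ is an isoperimetric minimizer: $\mu^+_K(tK)\le\mu^+_K(B)$ for every Borel set $B$ with $\mu(B)=\mu(tK)$. 1. If $q\in(0,1/n]$ and $\mu$ is a $q$-concave and $q$-homogeneous Borel measure on $\mathbb R^n$, then $(\ast)$ holds for every semi-norm $\|\cdot\|_K$. 2. If $p\in(0,\infty]$, $\frac1q=\frac1p+n$, and $w:\mathbb R^n\to[0,\infty)$ is a (Lebesgue) measurable $p$-concave and $p$-homogeneous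 function, then $(\ast)$ holds for $\mu=w(x)\,dx$, for every semi-norm $\|\cdot\|_K$. 3. In particular (Lions--Pacella), if $\Sigma\subset\mathbb R^n$ is a convex cone, then $(\ast)$ holds for the Lebesgue measure restricted to $\Sigma$, with $q=1/n$ and $K$ the open Euclidean unit ball; and (Cabré--Ros-Oton--Serra) if $\alpha>0$ and $w$ is a nonnegative measurable function which on $\Sigma$ is homogeneous of degree $\alpha$ with $w^{1/\alpha}$ concave, then $(\ast)$ holds for $\mu=w\,1_\Sigma\,dx$ with $\frac1q=n+\alpha$, for every semi-norm $\|\cdot\|_K$. -/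

import Mathlib

open MeasureTheory Filter Topology
open scoped ENNReal NNReal Pointwise

noncomputable section

/-- The weighted `ℓ_p`-average of `a` and `b` with weights `l` and `1 - l`, for `p ∈ [-∞, ∞]`:
the maximum if `p = ∞`, the minimum if `p = -∞`, the geometric mean `a ^ l * b ^ (1 - l)` if
`p = 0`, and `(l * a ^ p + (1 - l) * b ^ p) ^ (1 / p)` otherwise. -/
def lpAverage (p : EReal) (l : ℝ) (a b : ℝ≥0∞) : ℝ≥0∞ :=
  if p = ⊤ then max a b
  else if p = ⊥ then min a b
  else if p = 0 then a ^ l * b ^ (1 - l)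
  else (ENNReal.ofReal l * a ^ p.toReal + ENNReal.ofReal (1 - l) * b ^ p.toReal) ^ (1 / p.toReal)

/-- `p`-concavity of a nonnegative function `w` on `ℝⁿ` (measurability is stated separately). -/
def IsConcaveDensity {n : ℕ} (p : EReal) (w : EuclideanSpace ℝ (Fin n) → ℝ≥0) : Prop :=
  ∀ x y : EuclideanSpace ℝ (Fin n), 0 < w x → 0 < w y → ∀ l : ℝ, 0 < l → l < 1 →
    lpAverage p l (w x) (w y) ≤ (w (l • x + (1 - l) • y) : ℝ≥0∞)

/-- `q`-concavity of a Borel measure `μ` on `ℝⁿ`. The Minkowski combination of two Borel sets is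
analytic, hence possibly not Borel; `μ` of it is its (outer) measure, which for `σ`-finite `μ`
is its measure under the completion of `μ`. -/
def IsConcaveMeasure {n : ℕ} (q : EReal) (μ : Measure (EuclideanSpace ℝ (Fin n))) : Prop :=
  ∀ A B : Set (EuclideanSpace ℝ (Fin n)), MeasurableSet A → MeasurableSet B →
    0 < μ A → 0 < μ B → ∀ l : ℝ, 0 < l → l < 1 →
      lpAverage q l (μ A) (μ B) ≤ μ (l • A + (1 - l) • B)

/-- `p`-homogeneity, `p ∈ (-∞, ∞] \ {0}`, of a nonnegative function `w` on `ℝⁿ`: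
`w (c x) ^ p = c * w x ^ p` for all `c > 0`, read as `w (c x) = w x` if `p = ∞`. -/
def IsHomogeneousDensity {n : ℕ} (p : EReal) (w : EuclideanSpace ℝ (Fin n) → ℝ≥0) : Prop :=
  ∀ (x : EuclideanSpace ℝ (Fin n)) (c : ℝ), 0 < c →
    if p = ⊤ then w (c • x) = w x
    else (w (c • x) : ℝ≥0∞) ^ p.toReal = ENNReal.ofReal c * (w x : ℝ≥0∞) ^ p.toReal

/-- `q`-homogeneity, `q ∈ (-∞, ∞] \ {0}`, of a Borel measure `μ` on `ℝⁿ`: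
`μ (c A) ^ q = c * μ A ^ q` for all Borel sets `A` and `c > 0`, read as `μ (c A) = μ A`
if `q = ∞`. -/
def IsHomogeneousMeasure {n : ℕ} (q : EReal) (μ : Measure (EuclideanSpace ℝ (Fin n))) : Prop :=
  ∀ A : Set (EuclideanSpace ℝ (Fin n)), MeasurableSet A → ∀ c : ℝ, 0 < c →
    if q = ⊤ then μ (c • A) = μ A
    else μ (c • A) ^ q.toReal = ENNReal.ofReal c * μ A ^ q.toReal

/-- A semi-norm on `ℝⁿ` which is only required to be positively homogeneous: it need not be
symmetric. -/
structure IsPosSeminorm {n : ℕ} (N : EuclideanSpace ℝ (Fin n) → ℝ) : Prop where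
  nonneg : ∀ x, 0 ≤ N x
  smul : ∀ (c : ℝ) (x : EuclideanSpace ℝ (Fin n)), 0 ≤ c → N (c • x) = c * N x
  add_le : ∀ x y, N (x + y) ≤ N x + N y

/-- The outer Minkowski boundary measure `μ⁺_K(A)` of `A`, the liminf of `μ ((A + ε K) \ A) / ε`
as `ε` decreases to `0`. If `K` is the open unit ball of a semi-norm, then `A + ε K` is the open
`ε`-extension of `A`. -/
def outerBoundaryMeasure {n : ℕ} (μ : Measure (EuclideanSpace ℝ (Fin n)))
    (K A : Set (EuclideanSpace ℝ (Fin n))) : ℝ≥0∞ :=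
  liminf (fun ε : ℝ => μ ((A + ε • K) \ A) / ENNReal.ofReal ε) (𝓝[>] (0 : ℝ))

/-- `A` has the least outer boundary measure among all Borel sets of the same measure. -/
def IsIsoperimetricMinimizer {n : ℕ} (μ : Measure (EuclideanSpace ℝ (Fin n)))
    (K A : Set (EuclideanSpace ℝ (Fin n))) : Prop :=
  MeasurableSet A ∧ ∀ B : Set (EuclideanSpace ℝ (Fin n)), MeasurableSet B → μ B = μ A →
    outerBoundaryMeasure μ K A ≤ outerBoundaryMeasure μ K B

/-- The isoperimetric inequality `μ⁺_K(A) ≥ (1 / q) * μ K ^ q * μ A ^ (1 - q)` for all Borel sets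
`A` of finite measure, together with equality for the sets `t K`, `t > 0`, of finite measure and
their minimality. Null sets `A` are left out for `q = 1`, where `0 ^ (1 - q)` has to be read as
`0`, so that there is nothing to show for them. In `ℝ≥0∞` one has `∞ * 0 = 0`. -/
def SharpIsoperimetricInequality {n : ℕ} (μ : Measure (EuclideanSpace ℝ (Fin n))) (q : ℝ)
    (K : Set (EuclideanSpace ℝ (Fin n))) : Prop :=
  (∀ A : Set (EuclideanSpace ℝ (Fin n)), MeasurableSet A → μ A < ∞ → (q = 1 → 0 < μ A) →
    ENNReal.ofReal (1 / q) * μ K ^ q * μ A ^ (1 - q) ≤ outerBoundaryMeasure μ K A) ∧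
  (∀ t : ℝ, 0 < t → μ (t • K) < ∞ →
    outerBoundaryMeasure μ K (t • K) =
      ENNReal.ofReal (1 / q) * μ K ^ q * μ (t • K) ^ (1 - q)) ∧
  (∀ t : ℝ, 0 < t → μ (t • K) < ∞ → IsIsoperimetricMinimizer μ K (t • K))

end

/-! The isoperimetric inequality is the derivative at `ε = 0` of a Brunn-Minkowski inequality.
Concavity with weight 1/2, applied to `2A` and `2εK`, combines with homogeneity into `μ(A + εK)^q ≥
μ(A)^q + ε μ(K)^q` (`IsConcaveMeasure.rpow_add_rpow_le`). The derivative of `(a^q + ε k^q)^(1/q)` at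
0 is `(1/q) k^q a^(1-q)`. For `A = tK`, convexity gives `tK + εK = (t + ε)K` and every step is an
equality; the bound depends on `A` only through its measure, so `tK` is a minimizer.

Densities reduce to measures through the Borell-Brascamp-Lieb inequality. On the line it follows
from `|A| + |B| ≤ |A + B|` for superlevel sets of functions normalised to supremum 1, followed by
Hölder. Fubini and induction give dimension `n`. With means indexed by `s = 1/p`, each dimension
adds 1 to `s`, and `p = ∞` is the case `s = 0`. Weights on cones are extended by zero. -/

/-! ### Weighted means indexed by the reciprocal exponent -/

/-- The weighted `ℓ_p`-mean of `a` and `b` with `p = 1 / s`, read as the maximum if `s = 0`. -/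
noncomputable def recipMean (s : ℝ) (l m a b : ℝ≥0∞) : ℝ≥0∞ :=
  if s = 0 then max a b else (l * a ^ (1 / s) + m * b ^ (1 / s)) ^ s

lemma recipMean_zero (l m a b : ℝ≥0∞) : recipMean 0 l m a b = max a b := if_pos rfl

lemma recipMean_of_pos {s : ℝ} (hs : 0 < s) (l m a b : ℝ≥0∞) :
    recipMean s l m a b = (l * a ^ (1 / s) + m * b ^ (1 / s)) ^ s := if_neg hs.ne'

lemma recipMean_mono {s : ℝ} (hs : 0 ≤ s) (l m : ℝ≥0∞) {a b a' b' : ℝ≥0∞} (ha : a ≤ a')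
    (hb : b ≤ b') : recipMean s l m a b ≤ recipMean s l m a' b' := by
  rcases hs.eq_or_lt with rfl | hs
  · simpa only [recipMean_zero] using max_le_max ha hb
  · rw [recipMean_of_pos hs, recipMean_of_pos hs]
    gcongr

lemma recipMean_mul_left {s : ℝ} (hs : 0 ≤ s) (l m c a b : ℝ≥0∞) :
    recipMean s l m (c * a) (c * b) = c * recipMean s l m a b := by
  rcases hs.eq_or_lt with rfl | hs
  · simp only [recipMean_zero]
    exact (Monotone.map_max (f := fun x => c * x) fun x y hxy => by dsimp only; gcongr).symm
  · rw [recipMean_of_pos hs, recipMean_of_pos hs,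
      ENNReal.mul_rpow_of_nonneg _ _ (by positivity), ENNReal.mul_rpow_of_nonneg _ _ (by positivity),
      mul_left_comm l, mul_left_comm m, ← mul_add, ENNReal.mul_rpow_of_nonneg _ _ hs.le,
      ← ENNReal.rpow_mul, one_div_mul_cancel hs.ne', ENNReal.rpow_one]

lemma recipMean_ne_top {s : ℝ} (hs : 0 ≤ s) {l m a b : ℝ≥0∞} (hl : l ≠ ∞) (hm : m ≠ ∞)
    (ha : a ≠ ∞) (hb : b ≠ ∞) : recipMean s l m a b ≠ ∞ := by
  rcases hs.eq_or_lt with rfl | hs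
  · rw [recipMean_zero]
    exact (max_lt ha.lt_top hb.lt_top).ne
  · rw [recipMean_of_pos hs]
    have h : 0 ≤ 1 / s := by positivity
    exact ENNReal.rpow_ne_top_of_nonneg hs.le (ENNReal.add_ne_top.2
      ⟨ENNReal.mul_ne_top hl (ENNReal.rpow_ne_top_of_nonneg h ha),
        ENNReal.mul_ne_top hm (ENNReal.rpow_ne_top_of_nonneg h hb)⟩)

lemma recipMean_ne_zero {s : ℝ} (hs : 0 ≤ s) {l m a b : ℝ≥0∞} (hl : l ≠ 0)
    (ha : a ≠ 0) : recipMean s l m a b ≠ 0 := by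
  rcases hs.eq_or_lt with rfl | hs
  · rw [recipMean_zero]
    exact (lt_max_of_lt_left ha.bot_lt).ne'
  · rw [recipMean_of_pos hs]
    have h : 0 < 1 / s := by positivity
    simp [ENNReal.rpow_eq_zero_iff, hl, ha, hs, hs.not_gt]

lemma tendsto_recipMean {s : ℝ} (hs : 0 ≤ s) {l m : ℝ≥0∞} (hl : l ≠ ∞) (hm : m ≠ ∞)
    {ι : Type*} {F : Filter ι} {u v : ι → ℝ≥0∞} {a b : ℝ≥0∞} (hu : Tendsto u F (𝓝 a))
    (hv : Tendsto v F (𝓝 b)) :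
    Tendsto (fun i => recipMean s l m (u i) (v i)) F (𝓝 (recipMean s l m a b)) := by
  rcases hs.eq_or_lt with rfl | hs
  · simpa only [recipMean_zero] using hu.max hv
  · simp only [recipMean_of_pos hs]
    exact ((ENNReal.Tendsto.const_mul (hu.ennrpow_const _) (Or.inr hl)).add
      (ENNReal.Tendsto.const_mul (hv.ennrpow_const _) (Or.inr hm))).ennrpow_const _

/-- Hölder's inequality for two-point means. -/
lemma recipMean_mul_le {s : ℝ} (hs : 0 ≤ s) (l m F G a b : ℝ≥0∞) :
    recipMean (s + 1) l m (F * a) (G * b) ≤ recipMean s l m F G * (l * a + m * b) := by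
  rcases hs.eq_or_lt with rfl | hs
  · rw [recipMean_zero, recipMean_of_pos (by norm_num)]
    simp only [zero_add, div_one, ENNReal.rpow_one, mul_add]
    rw [mul_left_comm l, mul_left_comm m]
    gcongr
    · exact le_max_left _ _
    · exact le_max_right _ _
  · have hs1 : 0 < s + 1 := by linarith
    rw [recipMean_of_pos hs, recipMean_of_pos hs1]
    have hpq : ((s + 1) / s).HolderConjugate (s + 1) := by
      rw [Real.holderConjugate_iff]
      refine ⟨by rw [lt_div_iff₀ hs]; linarith, by field_simp⟩
    -- Each weight is shared between the two Hölder factors, with exponents `s/(s+1)` and `1/(s+1)`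
    -- summing to 1.
    have key (l F a : ℝ≥0∞) : (l * F ^ (1 / s)) ^ (s / (s + 1)) * (l * a) ^ (1 / (s + 1)) =
        l * (F * a) ^ (1 / (s + 1)) := by
      have h1 : 0 ≤ s / (s + 1) := by positivity
      have h2 : 0 ≤ 1 / (s + 1) := by positivity
      rw [ENNReal.mul_rpow_of_nonneg _ _ h1, ENNReal.mul_rpow_of_nonneg _ _ h2,
        ENNReal.mul_rpow_of_nonneg _ _ h2, ← ENNReal.rpow_mul, mul_mul_mul_comm,
        ← ENNReal.rpow_add_of_nonneg _ _ h1 h2]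
      rw [show s / (s + 1) + 1 / (s + 1) = 1 by field_simp,
        show 1 / s * (s / (s + 1)) = 1 / (s + 1) by field_simp, ENNReal.rpow_one]
    have := ENNReal.inner_le_Lp_mul_Lq Finset.univ
      ![(l * F ^ (1 / s)) ^ (s / (s + 1)), (m * G ^ (1 / s)) ^ (s / (s + 1))]
      ![(l * a) ^ (1 / (s + 1)), (m * b) ^ (1 / (s + 1))] hpq
    simp only [Fin.sum_univ_two, Matrix.cons_val_zero, Matrix.cons_val_one, key,
      ← ENNReal.rpow_mul] at this
    rw [show s / (s + 1) * ((s + 1) / s) = 1 by field_simp,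
      show 1 / (s + 1) * (s + 1) = 1 by field_simp] at this
    simp only [ENNReal.rpow_one] at this
    calc _ ≤ _ := ENNReal.rpow_le_rpow this hs1.le
      _ = _ := by
        rw [ENNReal.mul_rpow_of_nonneg _ _ hs1.le, ← ENNReal.rpow_mul, ← ENNReal.rpow_mul,
          one_div_mul_cancel hs1.ne', ENNReal.rpow_one,
          show 1 / ((s + 1) / s) * (s + 1) = s by field_simp]

/-! ### The Brunn-Minkowski inequality on the line -/

/-- `K + L` contains the translates `K + inf L` and `sup K + L`, which meet in at most the point
`sup K + inf L`. -/
lemma IsCompact.volume_add_volume_le {K L : Set ℝ} (hK : IsCompact K) (hL : IsCompact L)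
    (hK' : K.Nonempty) (hL' : L.Nonempty) : volume K + volume L ≤ volume (K + L) := by
  set M := sSup K
  set m := sInf L
  have hM : M ∈ K := hK.sSup_mem hK'
  have hm : m ∈ L := hL.sInf_mem hL'
  have h1 : volume ((fun x => x + m) '' K) = volume K := by
    rw [Set.image_add_right, measure_preimage_add_right]
  have h2 : volume ((fun x => M + x) '' L) = volume L := by
    rw [Set.image_add_left, measure_preimage_add]
  have hd : AEDisjoint volume ((fun x => x + m) '' K) ((fun x => M + x) '' L) := by
    refine measure_mono_null (t := {M + m}) ?_ (by simp)
    rintro _ ⟨⟨x, hx, rfl⟩, ⟨y, hy, hxy⟩⟩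
    have hx' : x ≤ M := le_csSup hK.bddAbove hx
    have hy' : m ≤ y := csInf_le hL.bddBelow hy
    simp only [Set.mem_singleton_iff]
    dsimp only at hxy
    linarith
  rw [← h1, ← h2, ← measure_union₀ (hL.image (by fun_prop)).measurableSet.nullMeasurableSet hd]
  refine measure_mono (Set.union_subset ?_ ?_)
  · rintro _ ⟨x, hx, rfl⟩
    exact Set.add_mem_add hx hm
  · rintro _ ⟨x, hx, rfl⟩
    exact Set.add_mem_add hM hx

/-- The Brunn-Minkowski inequality on the line. -/
theorem MeasurableSet.volume_add_volume_le {A B : Set ℝ} (hA : MeasurableSet A)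
    (hB : MeasurableSet B) (hA' : A.Nonempty) (hB' : B.Nonempty) :
    volume A + volume B ≤ volume (A + B) := by
  obtain ⟨a, ha⟩ := hA'
  obtain ⟨b, hb⟩ := hB'
  rw [hA.measure_eq_iSup_isCompact, hB.measure_eq_iSup_isCompact]
  simp only [iSup_and']
  refine ENNReal.biSup_add_biSup_le' ⟨∅, by simp⟩ ⟨∅, by simp⟩ ?_
  rintro K ⟨hKA, hK⟩ L ⟨hLB, hL⟩
  -- The approximating compact sets may be empty, and then so is `K + L`; adjoining `a` and `b`
  -- repairs this.
  calc volume K + volume L ≤ volume (insert a K) + volume (insert b L) := by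
        gcongr <;> exact Set.subset_insert _ _
    _ ≤ volume (insert a K + insert b L) := (hK.insert a).volume_add_volume_le (hL.insert b)
        (Set.insert_nonempty _ _) (Set.insert_nonempty _ _)
    _ ≤ volume (A + B) := by
        gcongr
        · exact Set.insert_subset ha hKA
        · exact Set.insert_subset hb hLB

/-! ### The Borell-Brascamp-Lieb inequality -/

lemma lintegral_eq_lintegral_measure_ofReal_lt {α : Type*} [MeasurableSpace α] (μ : Measure α)
    {f : α → ℝ≥0∞} (hf : Measurable f) (hf' : ∀ x, f x ≠ ∞) :
    ∫⁻ x, f x ∂μ = ∫⁻ t in Set.Ioi (0 : ℝ), μ {x | ENNReal.ofReal t < f x} := by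
  have := lintegral_eq_lintegral_meas_lt (f := fun x => (f x).toReal) μ
    (ae_of_all _ fun x => ENNReal.toReal_nonneg) hf.ennreal_toReal.aemeasurable
  simp only [ENNReal.ofReal_toReal (hf' _)] at this
  rw [this]
  refine setLIntegral_congr_fun measurableSet_Ioi fun t ht => ?_
  simp only [ENNReal.ofReal_lt_iff_lt_toReal (le_of_lt ht) (hf' _)]

/-- Since both suprema are 1, the superlevel sets of `f` and `g` are nonempty at every level `t <
1`, and their combination lies in that of `h`. Brunn-Minkowski on the line is then integrated over
`t`. -/
lemma lintegral_add_lintegral_le_of_min_le {f g h : ℝ → ℝ≥0∞} (hf : Measurable f)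
    (hg : Measurable g) (hh : Measurable h) (hf1 : ⨆ x, f x = 1) (hg1 : ⨆ x, g x = 1) {l : ℝ}
    (hl0 : 0 < l) (hl1 : l < 1)
    (H : ∀ x y, 0 < f x → 0 < g y → min (f x) (g y) ≤ h (l * x + (1 - l) * y)) :
    ENNReal.ofReal l * (∫⁻ x, f x) + ENNReal.ofReal (1 - l) * (∫⁻ x, g x) ≤ ∫⁻ x, h x := by
  have hf' (x) : f x ≤ 1 := hf1 ▸ le_iSup f x
  have hg' (x) : g x ≤ 1 := hg1 ▸ le_iSup g x
  have hl1' : 0 < 1 - l := by linarith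
  calc _ = (∫⁻ t in Set.Ioi (0 : ℝ), ENNReal.ofReal l * volume {x | ENNReal.ofReal t < f x}) +
        ∫⁻ t in Set.Ioi (0 : ℝ), ENNReal.ofReal (1 - l) * volume {x | ENNReal.ofReal t < g x} := by
        rw [lintegral_const_mul' _ _ ENNReal.ofReal_ne_top,
          lintegral_const_mul' _ _ ENNReal.ofReal_ne_top,
          lintegral_eq_lintegral_measure_ofReal_lt _ hf
            fun x => ((hf' x).trans_lt ENNReal.one_lt_top).ne,
          lintegral_eq_lintegral_measure_ofReal_lt _ hg
            fun x => ((hg' x).trans_lt ENNReal.one_lt_top).ne]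
    _ ≤ ∫⁻ t in Set.Ioi (0 : ℝ), (ENNReal.ofReal l * volume {x | ENNReal.ofReal t < f x} +
        ENNReal.ofReal (1 - l) * volume {x | ENNReal.ofReal t < g x}) := le_lintegral_add _ _
    -- Cutting `h` at 1 provides the finiteness that the layer-cake formula needs; `f` and `g` have
    -- no levels beyond 1.
    _ ≤ ∫⁻ t in Set.Ioi (0 : ℝ), volume {x | ENNReal.ofReal t < min (h x) 1} := by
        refine lintegral_mono fun t => ?_
        rcases lt_or_ge (ENNReal.ofReal t) 1 with ht | ht
        · have hA : {x | ENNReal.ofReal t < f x}.Nonempty := by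
            rw [← hf1] at ht
            exact lt_iSup_iff.1 ht
          have hB : {x | ENNReal.ofReal t < g x}.Nonempty := by
            rw [← hg1] at ht
            exact lt_iSup_iff.1 ht
          have hAm : MeasurableSet {x | ENNReal.ofReal t < f x} := measurableSet_lt (by fun_prop) hf
          have hBm : MeasurableSet {x | ENNReal.ofReal t < g x} := measurableSet_lt (by fun_prop) hg
          have := (hAm.const_smul₀ l).volume_add_volume_le (hBm.const_smul₀ (1 - l))
            (hA.smul_set) (hB.smul_set)
          rw [Measure.addHaar_smul, Measure.addHaar_smul, Module.finrank_self, pow_one, pow_one,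
            abs_of_pos hl0, abs_of_pos hl1'] at this
          refine this.trans (measure_mono ?_)
          rintro _ ⟨_, ⟨x, hx, rfl⟩, _, ⟨y, hy, rfl⟩, rfl⟩
          exact lt_min ((lt_min hx hy).trans_le (H x y (pos_of_gt hx) (pos_of_gt hy))) ht
        · have h1 : {x | ENNReal.ofReal t < f x} = ∅ :=
            Set.eq_empty_of_forall_notMem fun x hx => (hx.trans_le ((hf' x).trans ht)).false
          have h2 : {x | ENNReal.ofReal t < g x} = ∅ :=
            Set.eq_empty_of_forall_notMem fun x hx => (hx.trans_le ((hg' x).trans ht)).false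
          simp [h1, h2]
    _ = ∫⁻ x, min (h x) 1 := (lintegral_eq_lintegral_measure_ofReal_lt _
        (hh.min measurable_const) fun x => ((min_le_right _ _).trans_lt ENNReal.one_lt_top).ne).symm
    _ ≤ ∫⁻ x, h x := lintegral_mono fun x => min_le_left _ _

/-- The bound `k` makes the suprema `F`, `G` finite. Dividing `f`, `g`, `h` by `F`, `G` and the mean
`c` of `F`, `G` reduces to the normalised case, and Hölder reassembles the factors. -/
lemma recipMean_lintegral_le_of_bounded {s : ℝ} (hs : 0 ≤ s) {f g h : ℝ → ℝ≥0∞}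
    (hf : Measurable f) (hg : Measurable g) (hh : Measurable h) {k : ℝ≥0∞} (hk : k ≠ ∞)
    (hfk : ∀ x, f x ≤ k) (hgk : ∀ x, g x ≤ k) (hf0 : ∫⁻ x, f x ≠ 0) (hg0 : ∫⁻ x, g x ≠ 0)
    {l : ℝ} (hl0 : 0 < l) (hl1 : l < 1)
    (H : ∀ x y, 0 < f x → 0 < g y →
      recipMean s (ENNReal.ofReal l) (ENNReal.ofReal (1 - l)) (f x) (g y) ≤
        h (l * x + (1 - l) * y)) :
    recipMean (s + 1) (ENNReal.ofReal l) (ENNReal.ofReal (1 - l)) (∫⁻ x, f x) (∫⁻ x, g x) ≤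
      ∫⁻ x, h x := by
  have sup_ne {f : ℝ → ℝ≥0∞} (h : ∫⁻ x, f x ≠ 0) : ⨆ x, f x ≠ 0 := by
    contrapose! h
    simp only [ENNReal.iSup_eq_zero] at h
    simp [h]
  set F := ⨆ x, f x
  set G := ⨆ x, g x
  have hF0 : F ≠ 0 := sup_ne hf0
  have hG0 : G ≠ 0 := sup_ne hg0
  have hFt : F ≠ ∞ := ((iSup_le hfk).trans_lt hk.lt_top).ne
  have hGt : G ≠ ∞ := ((iSup_le hgk).trans_lt hk.lt_top).ne
  set L := ENNReal.ofReal l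
  set M := ENNReal.ofReal (1 - l)
  have hL : L ≠ 0 := by simpa [L] using hl0
  set c := recipMean s L M F G
  have hc0 : c ≠ 0 := recipMean_ne_zero hs hL hF0
  have hct : c ≠ ∞ := recipMean_ne_top hs ENNReal.ofReal_ne_top ENNReal.ofReal_ne_top hFt hGt
  have norm_one {f : ℝ → ℝ≥0∞} (h0 : ⨆ x, f x ≠ 0) (ht : ⨆ x, f x ≠ ∞) :
      ⨆ x, (⨆ x, f x)⁻¹ * f x = 1 := by
    rw [← ENNReal.mul_iSup, ENNReal.inv_mul_cancel h0 ht]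
  have key := lintegral_add_lintegral_le_of_min_le (f := fun x => F⁻¹ * f x)
    (g := fun x => G⁻¹ * g x) (h := fun x => c⁻¹ * h x) (hf.const_mul _) (hg.const_mul _)
    (hh.const_mul _) (norm_one hF0 hFt) (norm_one hG0 hGt) hl0 hl1 ?_
  · rw [lintegral_const_mul _ hf, lintegral_const_mul _ hg, lintegral_const_mul _ hh] at key
    have h1 := recipMean_mul_le hs L M F G (F⁻¹ * ∫⁻ x, f x) (G⁻¹ * ∫⁻ x, g x)
    rw [← mul_assoc, ← mul_assoc, ENNReal.mul_inv_cancel hF0 hFt, ENNReal.mul_inv_cancel hG0 hGt,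
      one_mul, one_mul] at h1
    calc _ ≤ _ := h1
      _ ≤ c * (c⁻¹ * ∫⁻ x, h x) := by gcongr
      _ = _ := by rw [← mul_assoc, ENNReal.mul_inv_cancel hc0 hct, one_mul]
  · intro x y hx hy
    have hx' : 0 < f x := pos_of_ne_zero fun h0 => by simp [h0] at hx
    have hy' : 0 < g y := pos_of_ne_zero fun h0 => by simp [h0] at hy
    -- With this common level, `f x ≥ t F` and `g y ≥ t G`, so the mean of `f x` and `g y` is at
    -- least `t c` by homogeneity.
    set t := min (F⁻¹ * f x) (G⁻¹ * g y)
    have h1 : t * F ≤ f x := by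
      calc t * F ≤ F⁻¹ * f x * F := by gcongr; exact min_le_left _ _
        _ = f x := by rw [mul_right_comm, ENNReal.inv_mul_cancel hF0 hFt, one_mul]
    have h2 : t * G ≤ g y := by
      calc t * G ≤ G⁻¹ * g y * G := by gcongr; exact min_le_right _ _
        _ = g y := by rw [mul_right_comm, ENNReal.inv_mul_cancel hG0 hGt, one_mul]
    have h3 : t * c ≤ h (l * x + (1 - l) * y) := by
      rw [← recipMean_mul_left hs]
      exact (recipMean_mono hs _ _ h1 h2).trans (H x y hx' hy')
    calc t = c⁻¹ * (t * c) := by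
          rw [mul_left_comm, ENNReal.inv_mul_cancel hc0 hct, mul_one]
      _ ≤ _ := by gcongr

lemma tendsto_min_natCast_lintegral {f : ℝ → ℝ≥0∞} (hf : Measurable f) :
    Tendsto (fun k : ℕ => ∫⁻ x, min (f x) k) atTop (𝓝 (∫⁻ x, f x)) := by
  refine lintegral_tendsto_of_tendsto_of_monotone
    (fun k => (hf.min measurable_const).aemeasurable) (ae_of_all _ fun x i j hij => ?_)
    (ae_of_all _ fun x => ?_)
  · exact min_le_min_left _ (by exact_mod_cast hij)
  · have := (tendsto_const_nhds (x := f x)).min ENNReal.tendsto_nat_nhds_top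
    simpa using this

/-- The Borell-Brascamp-Lieb inequality on the line. -/
theorem recipMean_lintegral_le_real {s : ℝ} (hs : 0 ≤ s) {f g h : ℝ → ℝ≥0∞}
    (hf : Measurable f) (hg : Measurable g) (hh : Measurable h)
    (hf0 : ∫⁻ x, f x ≠ 0) (hg0 : ∫⁻ x, g x ≠ 0) {l : ℝ} (hl0 : 0 < l) (hl1 : l < 1)
    (H : ∀ x y, 0 < f x → 0 < g y →
      recipMean s (ENNReal.ofReal l) (ENNReal.ofReal (1 - l)) (f x) (g y) ≤
        h (l * x + (1 - l) * y)) :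
    recipMean (s + 1) (ENNReal.ofReal l) (ENNReal.ofReal (1 - l)) (∫⁻ x, f x) (∫⁻ x, g x) ≤
      ∫⁻ x, h x := by
  -- Truncating `f` and `g` at `k` preserves `H` with the same `h`, because means are monotone.
  have hF := tendsto_min_natCast_lintegral hf
  have hG := tendsto_min_natCast_lintegral hg
  refine le_of_tendsto (tendsto_recipMean (by linarith) ENNReal.ofReal_ne_top
    ENNReal.ofReal_ne_top hF hG) ?_
  filter_upwards [hF.eventually_ne hf0, hG.eventually_ne hg0] with k hfk hgk
  refine recipMean_lintegral_le_of_bounded hs (hf.min measurable_const) (hg.min measurable_const)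
    hh (ENNReal.natCast_ne_top k) (fun x => min_le_right _ _) (fun x => min_le_right _ _) hfk hgk
    hl0 hl1 fun x y hx hy => ?_
  exact (recipMean_mono hs _ _ (min_le_left _ _) (min_le_left _ _)).trans
    (H x y (hx.trans_le (min_le_left _ _)) (hy.trans_le (min_le_left _ _)))

/-- The Borell-Brascamp-Lieb inequality. -/
theorem recipMean_lintegral_le_pi {s : ℝ} (hs : 0 ≤ s) {l : ℝ} (hl0 : 0 < l) (hl1 : l < 1)
    (n : ℕ) {f g h : (Fin n → ℝ) → ℝ≥0∞} (hf : Measurable f) (hg : Measurable g)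
    (hh : Measurable h) (hf0 : ∫⁻ x, f x ≠ 0) (hg0 : ∫⁻ x, g x ≠ 0)
    (H : ∀ x y, 0 < f x → 0 < g y →
      recipMean s (ENNReal.ofReal l) (ENNReal.ofReal (1 - l)) (f x) (g y) ≤
        h (l • x + (1 - l) • y)) :
    recipMean (s + n) (ENNReal.ofReal l) (ENNReal.ofReal (1 - l)) (∫⁻ x, f x) (∫⁻ x, g x) ≤
      ∫⁻ x, h x := by
  induction n with
  | zero =>
    -- `ℝ⁰` is a single point of mass 1, so the integrals are values and `H` is the claim.
    have hv : volume (Set.univ : Set (Fin 0 → ℝ)) = 1 := by simp [volume_pi]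
    simp only [lintegral_unique, hv, mul_one, Nat.cast_zero, add_zero] at hf0 hg0 ⊢
    refine (H _ _ (pos_of_ne_zero hf0) (pos_of_ne_zero hg0)).trans_eq ?_
    congr 1
    exact Subsingleton.elim _ _
  | succ n ih =>
    let e := MeasurableEquiv.piFinSuccAbove (fun _ : Fin (n + 1) => ℝ) 0
    have he : MeasurePreserving e.symm :=
      (volume_preserving_piFinSuccAbove (fun _ : Fin (n + 1) => ℝ) 0).symm
    have hfub {f : (Fin (n + 1) → ℝ) → ℝ≥0∞} (hf : Measurable f) :
        ∫⁻ z, f z = ∫⁻ x, ∫⁻ y, f (e.symm (x, y)) := by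
      rw [← he.lintegral_comp hf, Measure.volume_eq_prod,
        lintegral_prod (fun z => f (e.symm z)) (hf.comp e.symm.measurable).aemeasurable]
    have hcomb (x x' : ℝ) (y y' : Fin n → ℝ) : e.symm (l * x + (1 - l) * x',
        l • y + (1 - l) • y') = l • e.symm (x, y) + (1 - l) • e.symm (x', y') := by
      ext i
      refine Fin.cases ?_ (fun j => ?_) i <;>
        simp [e, MeasurableEquiv.piFinSuccAbove, Fin.insertNthEquiv]
    have hm {f : (Fin (n + 1) → ℝ) → ℝ≥0∞} (hf : Measurable f) :
        Measurable fun x => ∫⁻ y, f (e.symm (x, y)) :=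
      (hf.comp e.symm.measurable).lintegral_prod_right'
    have hm' {f : (Fin (n + 1) → ℝ) → ℝ≥0∞} (hf : Measurable f) (x : ℝ) :
        Measurable fun y => f (e.symm (x, y)) := by
      exact (hf.comp e.symm.measurable).comp measurable_prodMk_left
    rw [hfub hf, hfub hg, hfub hh]
    rw [hfub hf] at hf0
    rw [hfub hg] at hg0
    rw [Nat.cast_succ, ← add_assoc]
    -- The slice integrals satisfy the one-dimensional hypothesis with exponent `s + n`, by `ih`
    -- applied to the slices.
    refine recipMean_lintegral_le_real (by positivity) (hm hf) (hm hg) (hm hh) hf0 hg0 hl0 hl1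
      fun x x' hx hx' => ?_
    refine ih (hm' hf x) (hm' hg x') (hm' hh _) hx.ne' hx'.ne' fun y y' hy hy' => ?_
    rw [hcomb]
    exact H _ _ hy hy'

/-! ### Homogeneous concave densities induce homogeneous concave measures -/

/-- The default values `⊤.toReal = 0` and `0⁻¹ = 0` send `p = ∞` to `s = 0`, the case of the
maximum. -/
lemma lpAverage_eq_recipMean {p : EReal} (hp : 0 < p) (l : ℝ) (a b : ℝ≥0∞) :
    lpAverage p l a b = recipMean p.toReal⁻¹ (ENNReal.ofReal l) (ENNReal.ofReal (1 - l)) a b := by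
  induction p with
  | bot => simp at hp
  | top => simp [lpAverage, recipMean_zero]
  | coe p =>
    have hp' : 0 < p := by exact_mod_cast hp
    rw [EReal.toReal_coe, recipMean_of_pos (by positivity)]
    simp [lpAverage, hp'.ne']

lemma lpAverage_coe {q : ℝ} (hq : 0 < q) (l : ℝ) (a b : ℝ≥0∞) :
    lpAverage (q : EReal) l a b =
      (ENNReal.ofReal l * a ^ q + ENNReal.ofReal (1 - l) * b ^ q) ^ (1 / q) := by
  simp [lpAverage, hq.ne']

lemma inv_eq_inv_toReal_add_of_one_div_eq {n : ℕ} {p : EReal} {q : ℝ} (hp : 0 < p)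
    (h : 1 / (q : EReal) = 1 / p + (n : EReal)) : q⁻¹ = p.toReal⁻¹ + n := by
  have h1 : 1 / p = ((p.toReal⁻¹ : ℝ) : EReal) := by
    induction p with
    | bot => simp at hp
    | top => simp
    | coe p => rw [EReal.toReal_coe, EReal.coe_inv, one_div]
  rw [h1, one_div, ← EReal.coe_inv] at h
  exact_mod_cast h

/-- An almost everywhere equal representative could violate the concavity inequality, which is
pointwise. Bounds valid everywhere keep it: the minorant replaces the functions being averaged, the
majorant the one above them. -/
lemma AEMeasurable.exists_measurable_le_le {α : Type*} [MeasurableSpace α] {μ : Measure α}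
    {f : α → ℝ≥0∞} (hf : AEMeasurable f μ) :
    ∃ u v : α → ℝ≥0∞, Measurable u ∧ Measurable v ∧ (∀ x, u x ≤ f x) ∧ (∀ x, f x ≤ v x) ∧
      u =ᵐ[μ] f ∧ v =ᵐ[μ] f := by
  classical
  set N := toMeasurable μ {x | f x ≠ hf.mk f x}
  have hN : μ N = 0 := by
    rw [measure_toMeasurable]
    exact hf.ae_eq_mk
  have hNm : MeasurableSet N := measurableSet_toMeasurable _ _
  have hfN {x : α} (hx : x ∉ N) : f x = hf.mk f x := by
    by_contra h
    exact hx (subset_toMeasurable _ _ h)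
  have hae : ∀ᵐ x ∂μ, x ∉ N := measure_eq_zero_iff_ae_notMem.1 hN
  refine ⟨N.piecewise 0 (hf.mk f), N.piecewise ⊤ (hf.mk f),
    measurable_const.piecewise hNm hf.measurable_mk,
    measurable_const.piecewise hNm hf.measurable_mk, fun x => ?_, fun x => ?_, ?_, ?_⟩
  · by_cases hx : x ∈ N <;> simp [hx, hfN]
  · by_cases hx : x ∈ N <;> simp [hx, hfN]
  · filter_upwards [hae] with x hx using by simp [hx, hfN]
  · filter_upwards [hae] with x hx using by simp [hx, hfN]

/-- The Borell-Brascamp-Lieb inequality in Euclidean space. -/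
theorem recipMean_lintegral_le_euclideanSpace {n : ℕ} {s : ℝ} (hs : 0 ≤ s) {l : ℝ} (hl0 : 0 < l)
    (hl1 : l < 1) {f g h : EuclideanSpace ℝ (Fin n) → ℝ≥0∞} (hf : Measurable f)
    (hg : Measurable g) (hh : Measurable h) (hf0 : ∫⁻ x, f x ≠ 0) (hg0 : ∫⁻ x, g x ≠ 0)
    (H : ∀ x y, 0 < f x → 0 < g y →
      recipMean s (ENNReal.ofReal l) (ENNReal.ofReal (1 - l)) (f x) (g y) ≤
        h (l • x + (1 - l) • y)) :
    recipMean (s + n) (ENNReal.ofReal l) (ENNReal.ofReal (1 - l)) (∫⁻ x, f x) (∫⁻ x, g x) ≤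
      ∫⁻ x, h x := by
  have he := PiLp.volume_preserving_toLp (Fin n)
  rw [← he.lintegral_comp hf] at hf0 ⊢
  rw [← he.lintegral_comp hg] at hg0 ⊢
  rw [← he.lintegral_comp hh]
  refine recipMean_lintegral_le_pi hs hl0 hl1 n (hf.comp he.measurable) (hg.comp he.measurable)
    (hh.comp he.measurable) hf0 hg0 fun x y hx hy => ?_
  exact H _ _ hx hy

/-- Borell's theorem: a density which is `p`-concave, `p > 0`, with respect to the Lebesgue
measure on `ℝⁿ` induces a `q`-concave measure, where `1 / q = 1 / p + n`. -/
theorem IsConcaveDensity.isConcaveMeasure {n : ℕ} {p : EReal} {q : ℝ}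
    {w : EuclideanSpace ℝ (Fin n) → ℝ≥0} (hp : 0 < p) (hq : 0 < q)
    (hpq : q⁻¹ = p.toReal⁻¹ + n) (hw : AEMeasurable w volume) (hc : IsConcaveDensity p w) :
    IsConcaveMeasure (q : EReal) (volume.withDensity fun x => (w x : ℝ≥0∞)) := by
  intro A B hA hB hA0 hB0 l hl0 hl1
  have hs : 0 ≤ p.toReal⁻¹ := inv_nonneg.2 (EReal.toReal_nonneg hp.le)
  obtain ⟨u, v, hu, hv, huw, hwv, hu', hv'⟩ := hw.coe_nnreal_ennreal.exists_measurable_le_le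
  rw [lpAverage_eq_recipMean (by exact_mod_cast hq), EReal.toReal_coe, hpq,
    ← measure_toMeasurable (l • A + (1 - l) • B)]
  -- The Minkowski combination need not be measurable; its measurable hull has the same measure.
  set T := toMeasurable (volume.withDensity fun x => (w x : ℝ≥0∞)) (l • A + (1 - l) • B)
  have hT : MeasurableSet T := measurableSet_toMeasurable _ _
  have hint {S : Set (EuclideanSpace ℝ (Fin n))} (hS : MeasurableSet S)
      {u : EuclideanSpace ℝ (Fin n) → ℝ≥0∞} (hu : u =ᵐ[volume] fun x => (w x : ℝ≥0∞)) :
      (volume.withDensity fun x => (w x : ℝ≥0∞)) S = ∫⁻ x, S.indicator u x := by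
    rw [withDensity_apply _ hS, lintegral_indicator hS]
    exact lintegral_congr_ae (ae_restrict_of_ae hu.symm)
  rw [hint hA hu'] at hA0 ⊢
  rw [hint hB hu'] at hB0 ⊢
  rw [hint hT hv']
  refine recipMean_lintegral_le_euclideanSpace hs hl0 hl1 (hu.indicator hA) (hu.indicator hB)
    (hv.indicator hT) hA0.ne' hB0.ne' fun x y hx hy => ?_
  have hxA : x ∈ A := Set.mem_of_indicator_ne_zero hx.ne'
  have hyB : y ∈ B := Set.mem_of_indicator_ne_zero hy.ne'
  rw [Set.indicator_of_mem hxA] at hx ⊢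
  rw [Set.indicator_of_mem hyB] at hy ⊢
  have hz : l • x + (1 - l) • y ∈ T := subset_toMeasurable _ _
    (Set.add_mem_add (Set.smul_mem_smul_set hxA) (Set.smul_mem_smul_set hyB))
  rw [Set.indicator_of_mem hz]
  calc _ ≤ _ := recipMean_mono hs _ _ (huw x) (huw y)
    _ = _ := (lpAverage_eq_recipMean hp _ _ _).symm
    _ ≤ _ := hc x y (by exact_mod_cast hx.trans_le (huw x)) (by exact_mod_cast hy.trans_le (huw y))
      l hl0 hl1
    _ ≤ _ := hwv _

lemma IsHomogeneousDensity.apply_smul {n : ℕ} {p : EReal} {w : EuclideanSpace ℝ (Fin n) → ℝ≥0}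
    (hp : 0 < p) (hw : IsHomogeneousDensity p w) (x : EuclideanSpace ℝ (Fin n)) {c : ℝ}
    (hc : 0 < c) : (w (c • x) : ℝ≥0∞) = ENNReal.ofReal c ^ p.toReal⁻¹ * w x := by
  have h := hw x c hc
  induction p with
  | bot => simp at hp
  | top => simpa using h
  | coe p =>
    have hp' : 0 < p := by exact_mod_cast hp
    rw [if_neg (EReal.coe_ne_top p), EReal.toReal_coe] at h
    rw [EReal.toReal_coe, ← ENNReal.rpow_rpow_inv hp'.ne' (w (c • x)), h,
      ENNReal.mul_rpow_of_nonneg _ _ (by positivity), ENNReal.rpow_rpow_inv hp'.ne']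

/-- Under `x ↦ c x` the Jacobian contributes `c^n` and the density `c^(1/p)`, in total `c^(1/q)`. -/
theorem IsHomogeneousDensity.isHomogeneousMeasure {n : ℕ} {p : EReal} {q : ℝ}
    {w : EuclideanSpace ℝ (Fin n) → ℝ≥0} (hp : 0 < p) (hq : 0 < q)
    (hpq : q⁻¹ = p.toReal⁻¹ + n) (hw : IsHomogeneousDensity p w) :
    IsHomogeneousMeasure (q : EReal) (volume.withDensity fun x => (w x : ℝ≥0∞)) := by
  intro A hA c hc
  have hs : 0 ≤ p.toReal⁻¹ := inv_nonneg.2 (EReal.toReal_nonneg hp.le)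
  rw [if_neg (EReal.coe_ne_top q), EReal.toReal_coe]
  have hc0 : ENNReal.ofReal c ≠ 0 := by simpa using hc
  have hemb : MeasurableEmbedding fun x : EuclideanSpace ℝ (Fin n) => c • x :=
    measurableEmbedding_const_smul₀ hc.ne'
  have hpre : (fun x : EuclideanSpace ℝ (Fin n) => c • x) ⁻¹' (c • A) = A :=
    hemb.injective.preimage_image A
  have hcn : ENNReal.ofReal |(c ^ Module.finrank ℝ (EuclideanSpace ℝ (Fin n)))⁻¹| =
      (ENNReal.ofReal c ^ (n : ℝ))⁻¹ := by
    rw [finrank_euclideanSpace_fin, abs_of_pos (by positivity), ENNReal.rpow_natCast,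
      ENNReal.ofReal_inv_of_pos (by positivity), ENNReal.ofReal_pow hc.le]
  have key : (ENNReal.ofReal c ^ (n : ℝ))⁻¹ * ∫⁻ x in c • A, (w x : ℝ≥0∞) =
      ENNReal.ofReal c ^ p.toReal⁻¹ * ∫⁻ x in A, (w x : ℝ≥0∞) := by
    rw [← hcn, ← smul_eq_mul, ← lintegral_smul_measure, ← Measure.restrict_smul,
      ← Measure.map_addHaar_smul volume hc.ne', hemb.restrict_map, hpre, hemb.lintegral_map,
      ← lintegral_const_mul' _ _ (ENNReal.rpow_ne_top_of_nonneg hs ENNReal.ofReal_ne_top)]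
    simp only [hw.apply_smul hp _ hc]
  have h0 : ENNReal.ofReal c ^ (n : ℝ) ≠ 0 := by simp [hc]
  have ht : ENNReal.ofReal c ^ (n : ℝ) ≠ ∞ := by simp
  have hmul : (∫⁻ x in c • A, (w x : ℝ≥0∞)) =
      ENNReal.ofReal c ^ q⁻¹ * ∫⁻ x in A, (w x : ℝ≥0∞) := by
    rw [hpq, ENNReal.rpow_add_of_nonneg _ _ hs (by positivity), mul_comm (_ ^ _), mul_assoc, ← key,
      ← mul_assoc, ENNReal.mul_inv_cancel h0 ht, one_mul]
  rw [withDensity_apply _ hA, withDensity_apply _ (hA.const_smul₀ c), hmul,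
    ENNReal.mul_rpow_of_nonneg _ _ hq.le, ENNReal.rpow_inv_rpow hq.ne']

/-! ### The isoperimetric inequality for homogeneous concave measures -/

lemma IsPosSeminorm.convexOn {n : ℕ} {N : EuclideanSpace ℝ (Fin n) → ℝ} (hN : IsPosSeminorm N) :
    ConvexOn ℝ Set.univ N := by
  refine ⟨convex_univ, fun x _ y _ a b ha hb _ => ?_⟩
  rw [smul_eq_mul, smul_eq_mul, ← hN.smul a x ha, ← hN.smul b y hb]
  exact hN.add_le _ _

lemma IsPosSeminorm.isOpen_ball {n : ℕ} {N : EuclideanSpace ℝ (Fin n) → ℝ}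
    (hN : IsPosSeminorm N) : IsOpen {x | N x < 1} :=
  isOpen_lt hN.convexOn.locallyLipschitz.continuous continuous_const

lemma IsPosSeminorm.convex_ball {n : ℕ} {N : EuclideanSpace ℝ (Fin n) → ℝ}
    (hN : IsPosSeminorm N) : Convex ℝ {x | N x < 1} := by
  simpa using hN.convexOn.convex_lt 1

lemma IsPosSeminorm.smul_ball_subset {n : ℕ} {N : EuclideanSpace ℝ (Fin n) → ℝ}
    (hN : IsPosSeminorm N) {s t : ℝ} (hs : 0 < s) (hst : s ≤ t) :
    s • {x | N x < 1} ⊆ t • {x | N x < 1} := by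
  have h0 : (0 : EuclideanSpace ℝ (Fin n)) ∈ {x | N x < 1} := by
    have := hN.smul 0 0 le_rfl
    simp_all
  rintro _ ⟨x, hx, rfl⟩
  have ht : 0 < t := hs.trans_le hst
  refine ⟨(s / t) • x, ?_, ?_⟩
  · exact hN.convex_ball.smul_mem_of_zero_mem h0 hx
      ⟨by positivity, (div_le_one ht).2 hst⟩
  · simp only [smul_smul, mul_div_cancel₀ _ ht.ne']

/-- The one derivative behind both the inequality and its equality case. -/
lemma tendsto_rpow_add_sub_div {q : ℝ} (hq0 : 0 < q) (hq1 : q ≤ 1) {a k : ℝ≥0∞} (ha : a ≠ ∞)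
    (hk : k ≠ ∞) :
    Tendsto (fun ε : ℝ => ((a ^ q + ENNReal.ofReal ε * k ^ q) ^ (1 / q) - a) / ENNReal.ofReal ε)
      (𝓝[>] 0) (𝓝 (ENNReal.ofReal (1 / q) * k ^ q * a ^ (1 - q))) := by
  lift a to ℝ≥0 using ha
  lift k to ℝ≥0 using hk
  have hq' : 1 ≤ 1 / q := by rwa [le_div_iff₀ hq0, one_mul]
  have hd : HasDerivAt (fun ε : ℝ => ((a : ℝ) ^ q + ε * (k : ℝ) ^ q) ^ (1 / q))
      (1 / q * (k : ℝ) ^ q * (a : ℝ) ^ (1 - q)) 0 := by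
    have h1 : HasDerivAt (fun ε : ℝ => (a : ℝ) ^ q + ε * (k : ℝ) ^ q) (1 * (k : ℝ) ^ q) 0 :=
      ((hasDerivAt_id (0 : ℝ)).mul_const _).const_add _
    -- Since `1/q ≥ 1`, the power is differentiable even when `a = 0`; for `q = 1` the convention
    -- `0^0 = 1` gives the correct value `k`.
    convert h1.rpow_const (p := 1 / q) (Or.inr hq') using 1
    rw [zero_mul, add_zero, ← Real.rpow_mul a.coe_nonneg, mul_sub, mul_one, mul_one_div_cancel hq0.ne']
    ring
  have hlim := hd.tendsto_slope_zero_right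
  have h2 := (ENNReal.continuous_ofReal.tendsto _).comp hlim
  have h3 : ENNReal.ofReal (1 / q * (k : ℝ) ^ q * (a : ℝ) ^ (1 - q)) =
      ENNReal.ofReal (1 / q) * (k : ℝ≥0∞) ^ q * (a : ℝ≥0∞) ^ (1 - q) := by
    rw [ENNReal.ofReal_mul (by positivity), ENNReal.ofReal_mul (by positivity),
      ← ENNReal.ofReal_rpow_of_nonneg k.coe_nonneg hq0.le,
      ← ENNReal.ofReal_rpow_of_nonneg a.coe_nonneg (by linarith), ENNReal.ofReal_coe_nnreal,
      ENNReal.ofReal_coe_nnreal]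
  rw [h3] at h2
  refine h2.congr' ?_
  filter_upwards [self_mem_nhdsWithin] with ε hε
  have hε : 0 < ε := hε
  simp only [Function.comp_apply, zero_add, zero_mul, add_zero, smul_eq_mul]
  rw [← Real.rpow_mul a.coe_nonneg, mul_one_div_cancel hq0.ne', Real.rpow_one, ← div_eq_inv_mul,
    ENNReal.ofReal_div_of_pos hε, ENNReal.ofReal_sub _ a.coe_nonneg, ENNReal.ofReal_coe_nnreal,
    ← ENNReal.ofReal_rpow_of_nonneg (by positivity) (by positivity),
    ENNReal.ofReal_add (by positivity) (by positivity), ENNReal.ofReal_mul hε.le,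
    ← ENNReal.ofReal_rpow_of_nonneg k.coe_nonneg hq0.le,
    ← ENNReal.ofReal_rpow_of_nonneg a.coe_nonneg hq0.le, ENNReal.ofReal_coe_nnreal,
    ENNReal.ofReal_coe_nnreal]

section Isoperimetry

variable {n : ℕ} {q : ℝ} {μ : Measure (EuclideanSpace ℝ (Fin n))}

lemma IsHomogeneousMeasure.rpow_smul (hμ : IsHomogeneousMeasure (q : EReal) μ)
    {A : Set (EuclideanSpace ℝ (Fin n))} (hA : MeasurableSet A) {c : ℝ} (hc : 0 < c) :
    μ (c • A) ^ q = ENNReal.ofReal c * μ A ^ q := by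
  simpa using hμ A hA c hc

lemma IsHomogeneousMeasure.apply_smul (hq : 0 < q) (hμ : IsHomogeneousMeasure (q : EReal) μ)
    {A : Set (EuclideanSpace ℝ (Fin n))} (hA : MeasurableSet A) {c : ℝ} (hc : 0 < c) :
    μ (c • A) = (ENNReal.ofReal c * μ A ^ q) ^ (1 / q) := by
  rw [← hμ.rpow_smul hA hc, one_div, ENNReal.rpow_rpow_inv hq.ne']

/-- The Brunn-Minkowski inequality for homogeneous concave measures. -/
theorem IsConcaveMeasure.rpow_add_rpow_le (hq : 0 < q) (hc : IsConcaveMeasure (q : EReal) μ)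
    (hh : IsHomogeneousMeasure (q : EReal) μ) {A K : Set (EuclideanSpace ℝ (Fin n))}
    (hA : MeasurableSet A) (hK : MeasurableSet K) (hA0 : μ A ≠ 0) (hK0 : μ K ≠ 0) {ε : ℝ}
    (hε : 0 < ε) :
    (μ A ^ q + ENNReal.ofReal ε * μ K ^ q) ^ (1 / q) ≤ μ (A + ε • K) := by
  have pos {S : Set (EuclideanSpace ℝ (Fin n))} (hS : MeasurableSet S) (hS0 : μ S ≠ 0) {c : ℝ}
      (hc : 0 < c) : 0 < μ (c • S) := by
    rw [pos_iff_ne_zero, ne_eq, hh.apply_smul hq hS hc, ENNReal.rpow_eq_zero_iff]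
    simp [hc, hS0, hq, hq.not_gt, ENNReal.rpow_eq_zero_iff]
  have h2ε : 0 < 2 * ε := by positivity
  -- The factors 2 cancel the weights 1/2, in the sets as well as in the mean, leaving `A + εK` and
  -- coefficients 1 and `ε`.
  have h := hc ((2 : ℝ) • A) ((2 * ε) • K) (hA.const_smul₀ _) (hK.const_smul₀ _)
    (pos hA hA0 two_pos) (pos hK hK0 h2ε) (1 / 2) (by norm_num) (by norm_num)
  rw [lpAverage_coe hq, hh.rpow_smul hA two_pos, hh.rpow_smul hK h2ε, ← mul_assoc, ← mul_assoc,
    ← ENNReal.ofReal_mul (by norm_num), ← ENNReal.ofReal_mul (by norm_num), smul_smul,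
    smul_smul] at h
  rw [show (1 / 2 : ℝ) * 2 = 1 by norm_num, show (1 - 1 / 2 : ℝ) * (2 * ε) = ε by ring,
    ENNReal.ofReal_one, one_mul, one_smul] at h
  exact h

theorem IsConcaveMeasure.le_outerBoundaryMeasure (hq0 : 0 < q) (hq1 : q ≤ 1)
    (hc : IsConcaveMeasure (q : EReal) μ) (hh : IsHomogeneousMeasure (q : EReal) μ)
    {A K : Set (EuclideanSpace ℝ (Fin n))} (hA : MeasurableSet A) (hK : MeasurableSet K)
    (hAt : μ A < ∞) (hA0 : q = 1 → 0 < μ A) :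
    ENNReal.ofReal (1 / q) * μ K ^ q * μ A ^ (1 - q) ≤ outerBoundaryMeasure μ K A := by
  rcases eq_or_ne (μ K) 0 with hK0 | hK0
  · simp [hK0, hq0]
  rcases eq_or_ne (μ A) 0 with hA0' | hA0'
  · have : 0 < 1 - q := sub_pos.2 (lt_of_le_of_ne hq1 fun h => (hA0 h).ne' hA0')
    simp [hA0', this]
  have hle : ∀ᶠ ε : ℝ in 𝓝[>] 0,
      ((μ A ^ q + ENNReal.ofReal ε * μ K ^ q) ^ (1 / q) - μ A) / ENNReal.ofReal ε ≤
        μ ((A + ε • K) \ A) / ENNReal.ofReal ε := by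
    filter_upwards [self_mem_nhdsWithin] with ε hε
    gcongr
    -- The bound `μ S - μ A ≤ μ (S \ A)` needs no measurability of `S = A + εK`.
    exact (tsub_le_tsub_right (hc.rpow_add_rpow_le hq0 hh hA hK hA0' hK0 hε) _).trans
      le_measure_sdiff
  refine le_trans ?_ (liminf_le_liminf hle)
  -- If `μ K = ∞`, the lower quotients are infinite for every `ε > 0`.
  rcases eq_or_ne (μ K) ∞ with hKt | hKt
  · have htop : (fun ε : ℝ => ((μ A ^ q + ENNReal.ofReal ε * μ K ^ q) ^ (1 / q) - μ A) /
        ENNReal.ofReal ε) =ᶠ[𝓝[>] 0] fun _ => ∞ := by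
      filter_upwards [self_mem_nhdsWithin] with ε hε
      have hε : 0 < ε := hε
      have h0 : ENNReal.ofReal ε ≠ 0 := by simpa using hε
      rw [hKt, ENNReal.top_rpow_of_pos hq0, ENNReal.mul_top h0, add_top,
        ENNReal.top_rpow_of_pos (by positivity), ENNReal.top_sub hAt.ne,
        ENNReal.top_div_of_ne_top ENNReal.ofReal_ne_top]
    rw [liminf_congr htop, liminf_const]
    exact le_top
  · exact (tendsto_rpow_add_sub_div hq0 hq1 hAt.ne hKt).liminf_eq.ge

/-- By convexity `tK + εK = (t + ε)K`, so homogeneity evaluates the difference quotients exactly. -/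
theorem IsHomogeneousMeasure.outerBoundaryMeasure_smul_ball (hq0 : 0 < q) (hq1 : q ≤ 1)
    (hh : IsHomogeneousMeasure (q : EReal) μ) {N : EuclideanSpace ℝ (Fin n) → ℝ}
    (hN : IsPosSeminorm N) {t : ℝ} (ht : 0 < t) (hμt : μ (t • {x | N x < 1}) < ∞) :
    outerBoundaryMeasure μ {x | N x < 1} (t • {x | N x < 1}) =
      ENNReal.ofReal (1 / q) * μ {x | N x < 1} ^ q * μ (t • {x | N x < 1}) ^ (1 - q) := by
  set K := {x | N x < 1}
  have hK : MeasurableSet K := hN.isOpen_ball.measurableSet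
  have hKt : μ K ≠ ∞ := by
    intro h
    have h0 : ENNReal.ofReal t ≠ 0 := by simpa using ht
    rw [hh.apply_smul hq0 hK ht, h, ENNReal.top_rpow_of_pos hq0, ENNReal.mul_top h0,
      ENNReal.top_rpow_of_pos (by positivity)] at hμt
    exact hμt.false
  refine Tendsto.liminf_eq ((tendsto_rpow_add_sub_div hq0 hq1 hμt.ne hKt).congr' ?_)
  filter_upwards [self_mem_nhdsWithin] with ε hε
  have hε : 0 < ε := hε
  rw [← hN.convex_ball.add_smul ht.le hε.le,
    measure_sdiff (hN.smul_ball_subset ht (by linarith)) (hK.const_smul₀ t).nullMeasurableSet hμt.ne,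
    hh.apply_smul hq0 hK (by positivity : 0 < t + ε), ENNReal.ofReal_add ht.le hε.le, add_mul,
    ← hh.rpow_smul hK ht]

/-- The sharp isoperimetric inequality for `q`-concave and `q`-homogeneous measures. -/
theorem IsConcaveMeasure.sharpIsoperimetricInequality (hq0 : 0 < q) (hq1 : q ≤ 1)
    (hc : IsConcaveMeasure (q : EReal) μ) (hh : IsHomogeneousMeasure (q : EReal) μ)
    {N : EuclideanSpace ℝ (Fin n) → ℝ} (hN : IsPosSeminorm N) :
    SharpIsoperimetricInequality μ q {x | N x < 1} := by
  have hK : MeasurableSet {x | N x < 1} := hN.isOpen_ball.measurableSet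
  refine ⟨fun A hA hAt hA0 => hc.le_outerBoundaryMeasure hq0 hq1 hh hA hK hAt hA0,
    fun t ht hμt => hh.outerBoundaryMeasure_smul_ball hq0 hq1 hN ht hμt,
    fun t ht hμt => ⟨hK.const_smul₀ t, fun B hB hBt => ?_⟩⟩
  rw [hh.outerBoundaryMeasure_smul_ball hq0 hq1 hN ht hμt]
  -- If `μ K = 0`, the boundary measure of `tK` is 0. Otherwise `μ B = μ (tK) > 0`, which the
  -- inequality requires when `q = 1`.
  rcases eq_or_ne (μ {x | N x < 1}) 0 with hK0 | hK0
  · simp [hK0, hq0]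
  · rw [← hBt]
    refine hc.le_outerBoundaryMeasure hq0 hq1 hh hB hK (hBt ▸ hμt) fun _ => ?_
    rw [hBt, hh.apply_smul hq0 hK ht, pos_iff_ne_zero, ne_eq, ENNReal.rpow_eq_zero_iff]
    simp [ht, hK0, hq0, hq0.not_gt, ENNReal.rpow_eq_zero_iff]

end Isoperimetry

/-- The sharp isoperimetric inequality for `p`-concave and `p`-homogeneous densities. -/
theorem IsConcaveDensity.sharpIsoperimetricInequality {n : ℕ} (hn : 1 ≤ n) {p : EReal} {q : ℝ}
    {w : EuclideanSpace ℝ (Fin n) → ℝ≥0} (hp : 0 < p)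
    (hpq : 1 / (q : EReal) = 1 / p + (n : EReal)) (hw : AEMeasurable w volume)
    (hc : IsConcaveDensity p w) (hh : IsHomogeneousDensity p w)
    {N : EuclideanSpace ℝ (Fin n) → ℝ} (hN : IsPosSeminorm N) :
    SharpIsoperimetricInequality (volume.withDensity fun x => (w x : ℝ≥0∞)) q {x | N x < 1} := by
  have h := inv_eq_inv_toReal_add_of_one_div_eq hp hpq
  have hs : 0 ≤ p.toReal⁻¹ := inv_nonneg.2 (EReal.toReal_nonneg hp.le)
  have hn' : (1 : ℝ) ≤ n := by exact_mod_cast hn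
  -- Both `0 < q` and `q ≤ 1` come from `q⁻¹ = 1/p + n ≥ 1`.
  have h1 : 1 ≤ q⁻¹ := by linarith
  have hq0 : 0 < q := inv_pos.1 (by linarith)
  have hq1 : q ≤ 1 := (one_le_inv₀ hq0).1 h1
  exact (hc.isConcaveMeasure hp hq0 h hw).sharpIsoperimetricInequality hq0 hq1
    (hh.isHomogeneousMeasure hp hq0 h) hN

/-! ### Convex cones -/

lemma ConvexCone.smul_mem_iff_of_pos {E : Type*} [AddCommGroup E] [Module ℝ E] (C : ConvexCone ℝ E)
    {c : ℝ} (hc : 0 < c) {x : E} : c • x ∈ C ↔ x ∈ C := by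
  refine ⟨fun h => ?_, fun h => C.smul_mem hc h⟩
  simpa [smul_smul, hc.ne'] using C.smul_mem (inv_pos.2 hc) h

/-- Moves the cone into the density. A convex cone need not be Borel, but convex sets are null
measurable. -/
lemma withDensity_restrict_coe_eq_withDensity_indicator {α : Type*} [MeasurableSpace α]
    {μ : Measure α} {S : Set α} (hS : NullMeasurableSet S μ) (w : α → ℝ≥0) :
    (μ.restrict S).withDensity (fun x => (w x : ℝ≥0∞)) =
      μ.withDensity fun x => ((S.indicator w x : ℝ≥0) : ℝ≥0∞) := by
  ext A hA
  rw [withDensity_apply _ hA, withDensity_apply _ hA, Measure.restrict_restrict hA]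
  have : (fun x => ((S.indicator w x : ℝ≥0) : ℝ≥0∞)) = S.indicator fun x => (w x : ℝ≥0∞) := by
    ext x
    by_cases hx : x ∈ S <;> simp [hx]
  have hS' := hS.mono_ac (Measure.restrict_le_self (s := A)).absolutelyContinuous
  rw [this, lintegral_indicator₀ hS', Measure.restrict_restrict₀ hS', Set.inter_comm]

lemma isPosSeminorm_norm (n : ℕ) : IsPosSeminorm fun x : EuclideanSpace ℝ (Fin n) => ‖x‖ where
  nonneg := norm_nonneg
  smul c x hc := by rw [norm_smul, Real.norm_of_nonneg hc]
  add_le := norm_add_le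

/-- The sharp isoperimetric inequality in a convex cone. -/
theorem ConvexCone.sharpIsoperimetricInequality {n : ℕ} (hn : 1 ≤ n)
    (C : ConvexCone ℝ (EuclideanSpace ℝ (Fin n))) :
    SharpIsoperimetricInequality (volume.restrict (C : Set (EuclideanSpace ℝ (Fin n))))
      (1 / (n : ℝ)) (Metric.ball 0 1) := by
  have hC := C.convex.nullMeasurableSet volume
  have hμ : volume.restrict (C : Set (EuclideanSpace ℝ (Fin n))) = volume.withDensity fun x =>
      (((C : Set (EuclideanSpace ℝ (Fin n))).indicator (fun _ => (1 : ℝ≥0)) x : ℝ≥0) : ℝ≥0∞) := by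
    rw [← withDensity_restrict_coe_eq_withDensity_indicator hC fun _ => 1, withDensity_const,
      ENNReal.coe_one, one_smul]
  have hb : (Metric.ball 0 1 : Set (EuclideanSpace ℝ (Fin n))) = {x | ‖x‖ < 1} := by
    ext x
    simp
  have hmem {x} (h : 0 < (C : Set (EuclideanSpace ℝ (Fin n))).indicator (fun _ => (1 : ℝ≥0)) x) :
      x ∈ (C : Set (EuclideanSpace ℝ (Fin n))) := Set.mem_of_indicator_ne_zero h.ne'
  rw [hμ, hb]
  -- The indicator of a convex cone is `∞`-concave and invariant under dilations.
  refine IsConcaveDensity.sharpIsoperimetricInequality hn (p := ⊤) (by simp) ?_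
    ((aemeasurable_indicator_iff₀ hC).2 aemeasurable_const) ?_ ?_ (isPosSeminorm_norm n)
  · rw [one_div, ← EReal.coe_inv, one_div, inv_inv, EReal.div_top, zero_add]
    norm_cast
  · intro x y hx hy l hl0 hl1
    have hz := C.convex (hmem hx) (hmem hy) hl0.le (sub_pos.2 hl1).le (by ring)
    simp [lpAverage, Set.indicator_of_mem, hz, hmem hx, hmem hy]
  · intro x c hc
    rw [if_pos rfl]
    by_cases hx : x ∈ C
    · simp [hx, C.smul_mem hc hx]
    · simp [hx, C.smul_mem_iff_of_pos hc]

/-- The sharp isoperimetric inequality for homogeneous weights on a convex cone. -/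
theorem ConvexCone.sharpIsoperimetricInequality_withDensity {n : ℕ} (hn : 1 ≤ n)
    (C : ConvexCone ℝ (EuclideanSpace ℝ (Fin n))) {a : ℝ} {w : EuclideanSpace ℝ (Fin n) → ℝ≥0}
    (ha : 0 < a) (hw : AEMeasurable w (volume.restrict (C : Set (EuclideanSpace ℝ (Fin n)))))
    (hh : ∀ x ∈ C, ∀ c : ℝ, 0 < c → (w (c • x) : ℝ) = c ^ a * (w x : ℝ))
    (hc : ConcaveOn ℝ (C : Set (EuclideanSpace ℝ (Fin n))) (fun x => (w x : ℝ) ^ (1 / a)))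
    {N : EuclideanSpace ℝ (Fin n) → ℝ} (hN : IsPosSeminorm N) :
    SharpIsoperimetricInequality
      ((volume.restrict (C : Set (EuclideanSpace ℝ (Fin n)))).withDensity
        fun x => (w x : ℝ≥0∞)) (1 / ((n : ℝ) + a)) {x | N x < 1} := by
  have hC := C.convex.nullMeasurableSet volume
  rw [withDensity_restrict_coe_eq_withDensity_indicator hC]
  have hmem {x} (h : 0 < (C : Set (EuclideanSpace ℝ (Fin n))).indicator w x) :
      x ∈ (C : Set (EuclideanSpace ℝ (Fin n))) := Set.mem_of_indicator_ne_zero h.ne'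
  have ha' : 0 < 1 / a := by positivity
  -- Degree `a` corresponds to `p = 1/a`. Extension by zero keeps `p`-concavity, which is tested
  -- only at points of positive weight, all in `C`.
  refine IsConcaveDensity.sharpIsoperimetricInequality hn (p := ((1 / a : ℝ) : EReal))
    (by exact_mod_cast ha') ?_ ((aemeasurable_indicator_iff₀ hC).2 hw) ?_ ?_ hN
  · have h1 (r : ℝ) : 1 / ((1 / r : ℝ) : EReal) = (r : EReal) := by
      rw [one_div, ← EReal.coe_inv, one_div, inv_inv]
    rw [h1, h1, add_comm]
    norm_cast
  · intro x y hx hy l hl0 hl1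
    have hl1' : 0 < 1 - l := sub_pos.2 hl1
    have hz := C.convex (hmem hx) (hmem hy) hl0.le hl1'.le (by ring)
    have h := hc.2 (hmem hx) (hmem hy) hl0.le hl1'.le (by ring)
    simp only [smul_eq_mul] at h
    rw [lpAverage_coe ha', Set.indicator_of_mem (hmem hx), Set.indicator_of_mem (hmem hy),
      Set.indicator_of_mem hz, one_div_one_div]
    have h' : ENNReal.ofReal l * (w x : ℝ≥0∞) ^ (1 / a) +
        ENNReal.ofReal (1 - l) * (w y : ℝ≥0∞) ^ (1 / a) ≤
          (w (l • x + (1 - l) • y) : ℝ≥0∞) ^ (1 / a) := by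
      have := ENNReal.ofReal_le_ofReal h
      rw [ENNReal.ofReal_add (by positivity) (by positivity), ENNReal.ofReal_mul hl0.le,
        ENNReal.ofReal_mul hl1'.le, ← ENNReal.ofReal_rpow_of_nonneg (NNReal.coe_nonneg _) ha'.le,
        ← ENNReal.ofReal_rpow_of_nonneg (NNReal.coe_nonneg _) ha'.le,
        ← ENNReal.ofReal_rpow_of_nonneg (NNReal.coe_nonneg _) ha'.le] at this
      simpa only [ENNReal.ofReal_coe_nnreal] using this
    calc _ ≤ _ := ENNReal.rpow_le_rpow h' ha.le
      _ = _ := by rw [one_div, ENNReal.rpow_inv_rpow ha.ne']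
  · intro x c hc
    rw [if_neg (EReal.coe_ne_top _), EReal.toReal_coe]
    by_cases hx : x ∈ C
    · have hx' : c • x ∈ C := C.smul_mem hc hx
      have h := congrArg ENNReal.ofReal (hh x hx c hc)
      rw [ENNReal.ofReal_mul (by positivity), ← ENNReal.ofReal_rpow_of_nonneg hc.le ha.le,
        ENNReal.ofReal_coe_nnreal, ENNReal.ofReal_coe_nnreal] at h
      rw [Set.indicator_of_mem (show x ∈ (C : Set (EuclideanSpace ℝ (Fin n))) from hx),
        Set.indicator_of_mem (show c • x ∈ (C : Set (EuclideanSpace ℝ (Fin n))) from hx'), h,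
        ENNReal.mul_rpow_of_nonneg _ _ ha'.le, one_div, ENNReal.rpow_rpow_inv ha.ne']
    · have hx' : c • x ∉ C := by rwa [C.smul_mem_iff_of_pos hc]
      simp [hx, hx', ha]

/-- The sharp isoperimetric inequality for `q`-concave, `q`-homogeneous measures, for `p`-concave,
`p`-homogeneous densities, and its two classical instances in convex cones. -/
theorem mainTheorem7 (n : ℕ) (hn : 1 ≤ n) :
    -- `q`-concave and `q`-homogeneous measures with `q ∈ (0, 1/n]`
    (∀ (q : ℝ) (μ : Measure (EuclideanSpace ℝ (Fin n))), 0 < q → q ≤ 1 / (n : ℝ) →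
      IsConcaveMeasure (q : EReal) μ → IsHomogeneousMeasure (q : EReal) μ →
      ∀ N : EuclideanSpace ℝ (Fin n) → ℝ, IsPosSeminorm N →
        SharpIsoperimetricInequality μ q {x | N x < 1}) ∧
    -- densities which are `p`-concave and `p`-homogeneous with `p ∈ (0, ∞]`
    (∀ (p : EReal) (q : ℝ) (w : EuclideanSpace ℝ (Fin n) → ℝ≥0),
      0 < p → 1 / (q : EReal) = 1 / p + (n : EReal) → AEMeasurable w volume →
      IsConcaveDensity p w → IsHomogeneousDensity p w →
      ∀ N : EuclideanSpace ℝ (Fin n) → ℝ, IsPosSeminorm N →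
        SharpIsoperimetricInequality (volume.withDensity fun x => (w x : ℝ≥0∞)) q
          {x | N x < 1}) ∧
    -- Lebesgue measure in a convex cone, Euclidean ball (Lions--Pacella)
    (∀ C : ConvexCone ℝ (EuclideanSpace ℝ (Fin n)),
      SharpIsoperimetricInequality (volume.restrict (C : Set (EuclideanSpace ℝ (Fin n))))
        (1 / (n : ℝ)) (Metric.ball 0 1)) ∧
    -- weights on a convex cone, homogeneous of degree `a > 0` with `w ^ (1 / a)` concave
    -- (Cabré--Ros-Oton--Serra)
    (∀ (C : ConvexCone ℝ (EuclideanSpace ℝ (Fin n))) (a : ℝ)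
      (w : EuclideanSpace ℝ (Fin n) → ℝ≥0), 0 < a →
      AEMeasurable w (volume.restrict (C : Set (EuclideanSpace ℝ (Fin n)))) →
      (∀ x ∈ C, ∀ c : ℝ, 0 < c → (w (c • x) : ℝ) = c ^ a * (w x : ℝ)) →
      ConcaveOn ℝ (C : Set (EuclideanSpace ℝ (Fin n))) (fun x => (w x : ℝ) ^ (1 / a)) →
      ∀ N : EuclideanSpace ℝ (Fin n) → ℝ, IsPosSeminorm N →
        SharpIsoperimetricInequality
          ((volume.restrict (C : Set (EuclideanSpace ℝ (Fin n)))).withDensity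
            fun x => (w x : ℝ≥0∞))
          (1 / ((n : ℝ) + a)) {x | N x < 1}) := by
  refine ⟨fun q μ hq0 hq1 hc hh N hN => ?_, fun p q w hp hpq hw hc hh N hN =>
    hc.sharpIsoperimetricInequality hn hp hpq hw hh hN,
    fun C => C.sharpIsoperimetricInequality hn,
    fun C a w ha hw hh hc N hN => C.sharpIsoperimetricInequality_withDensity hn ha hw hh hc hN⟩
  refine hc.sharpIsoperimetricInequality hq0 (hq1.trans ?_) hh hN
  exact div_le_one_of_le₀ (by exact_mod_cast hn) (Nat.cast_nonneg n)
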